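/- Let $N$ be a dimension, let $Q$ and $B$ be real $N\times N$ matrices with $Q$ symmetric positive definite, and consider the Ornstein–Uhlenbeck equation with fractional diffusion $$\partial_t u = -\mathrm{tr}^s\left(-Q\nabla^2 u\right) + Bx\cdot\nabla u \quad (0<t<T,\ x\in\mathbb R^N), \qquad u|_{t=0}=u_0, \tag{$*$}$$ where $\mathrm{tr}^s(-Q\nabla^2\,\cdot)$ is the Fourier multiplier with symbol $\langle Q\xi,\xi\rangle^s$ (normalized so that $-i\nabla$ corresponds to multiplication by $\xi$). For every $s>0$ and $T>0$ there exist constants $c=c(s,T)\in(0,1]$ and $K=K(c,T)>0$ (which may also depend on the fixed data $N,Q,B$ of the equation) such that for every $u_0\in L^2(\mathbb R^N)$, the solution $u$ of $(*)$ satisfies $$\|u(t)\|_{L^2(\mathbb R^N)} \le K\,\|u_0\|_{L^2(\mathbb R^N)}^{1-c\frac tT}\,\|u(T)\|_{L^2(\mathbb R^N)}^{c\frac tT}, \qquad 0\le t\le T.$$ Here a solution is a function $u\in C([0,T];L^2(\mathbb R^N;\mathbb C))$ with $u(0)=u_0$ which satisfies the equation for $0<t<T$ in the sense of tempered distributions in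 $x$: for every Schwartz function $\varphi$, the function $t\mapsto\int u(t)\varphi\,dx$ is differentiable on $(0,T)$ with derivative $\langle -\mathrm{tr}^s(-Q\nabla^2u(t))+Bx\cdot\nabla u(t),\varphi\rangle$. (By convention $0^0=1$.) -/

import Mathlib

open MeasureTheory Set
open scoped FourierTransform SchwartzMap

noncomputable section

namespace FracOU

/-- The space `L²(ℝᴺ)` of complex-valued functions, with Lebesgue measure. -/
abbrev L2 (N : ℕ) : Type := Lp ℂ 2 (volume : Measure (EuclideanSpace ℝ (Fin N)))

/-- The symbol `⟨Q ξ, ξ⟩ ^ s`. -/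
def symbol {N : ℕ} (Q : Matrix (Fin N) (Fin N) ℝ) (s : ℝ) (ξ : EuclideanSpace ℝ (Fin N)) : ℝ :=
  (inner ℝ (Matrix.toEuclideanLin Q ξ) ξ) ^ s

/-- `tr^s(-Q∇² f)` for `f ∈ L²(ℝᴺ)`, as a tempered distribution: the inverse Fourier transform of
`symbol · 𝓕 f`, i.e. its value at a Schwartz function `φ` is `∫ symbol · 𝓕 f · 𝓕⁻¹ φ`.
Mathlib's Fourier transform has the kernel `exp (-2πi⟨x, ξ⟩)`, so that the frequency
(the variable `ξ` for which `-i∇` becomes multiplication by `ξ`) is `2π ξ`. -/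
def fracDiffusion {N : ℕ} (Q : Matrix (Fin N) (Fin N) ℝ) (s : ℝ) (f : L2 N)
    (φ : 𝓢(EuclideanSpace ℝ (Fin N), ℂ)) : ℂ :=
  ∫ ξ, (symbol Q s ((2 * Real.pi) • ξ) : ℂ) * ((𝓕 f : L2 N) ξ) *
    ((𝓕⁻ φ : 𝓢(EuclideanSpace ℝ (Fin N), ℂ)) ξ)

/-- The divergence of the vector field `x ↦ φ(x) B x`. -/
def divDrift {N : ℕ} (B : Matrix (Fin N) (Fin N) ℝ) (φ : 𝓢(EuclideanSpace ℝ (Fin N), ℂ))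
    (x : EuclideanSpace ℝ (Fin N)) : ℂ :=
  ∑ j : Fin N,
    fderiv ℝ (fun y : EuclideanSpace ℝ (Fin N) => ((Matrix.toEuclideanLin B y j : ℝ) : ℂ) * φ y) x
      (EuclideanSpace.single j (1 : ℝ))

/-- `B x · ∇ f` for `f ∈ L²(ℝᴺ)`, as a tempered distribution: `φ ↦ -∫ f div(φ B x) dx`. -/
def drift {N : ℕ} (B : Matrix (Fin N) (Fin N) ℝ) (f : L2 N)
    (φ : 𝓢(EuclideanSpace ℝ (Fin N), ℂ)) : ℂ :=
  -∫ x, f x * divDrift B φ x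

/-- `u` is a solution on `[0,T]` of `∂ₜ u = -tr^s(-Q∇² u) + B x · ∇ u`, `u(0) = u₀ ∈ L²(ℝᴺ)`:
it is continuous from `[0,T]` to `L²(ℝᴺ)`, takes the initial value `u₀`, and satisfies the
equation for `0 < t < T` in the sense of tempered distributions in `x`. -/
structure IsSolution {N : ℕ} (Q B : Matrix (Fin N) (Fin N) ℝ) (s T : ℝ) (u₀ : L2 N)
    (u : ℝ → L2 N) : Prop where
  continuousOn : ContinuousOn u (Icc 0 T)
  initial : u 0 = u₀
  equation : ∀ φ : 𝓢(EuclideanSpace ℝ (Fin N), ℂ), ∀ t ∈ Ioo 0 T,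
    HasDerivAt (fun τ => ∫ x, u τ x * φ x) (-fracDiffusion Q s (u t) φ + drift B (u t) φ) t

end FracOU

end

/-!
On the Fourier side the equation is first order: writing `w = 𝓕 u`, `A = Bᵀ` and
`a ξ = ⟨Q (2πξ), 2πξ⟩ ^ s`, it reads `∂ₜ w + div (w A ξ) + a w = 0`, which is solved along the
characteristics `ξ = exp (t A) η` by
`|det exp (t A)| w(t, exp (t A) η) = exp (-∫₀ᵗ a (exp (τ A) η) dτ) w(0, η)`.
Hence, up to Jacobians that are bounded on `[0,T]`, `‖u t‖²` is the integral of `|w(0)|²` against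
the weight `exp (-2 Φ t)`, where `Φ t η = ∫₀ᵗ a (exp (τ A) η) dτ` (`damping`). Positive definiteness
of `Q` makes all the functions `a ∘ exp (τ A)`, `0 ≤ τ ≤ T`, comparable, uniformly in `η`
(`exists_mul_symbol_flow_le`). Therefore `c (t / T) Φ T ≤ Φ t` (`mul_damping_le`), and Hölder's
inequality with the exponents `c t / T` and `1 - c t / T` gives the estimate
(`IsTransportSolution.norm_le`).

The work lies in deriving the solution formula for an arbitrary weak solution, by duality. The test
functions should be `ψ(t, ξ) = (χ exp (Φ t)) (exp (-t A) ξ)`, for which `∫ w(t) ψ(t)` is constant,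
but `a` need not be smooth at the origin, so that these are not Schwartz functions. The drift and
the damping are therefore removed one after the other. For smooth `χ` the function `χ ∘ exp (-t A)` is
admissible and absorbs the drift (`hasDerivAt_flow_of_contDiff`); in the resulting identity only
the values of `χ` occur, so it extends by uniform approximation to continuous compactly supported
`χ` (`IsTransportSolution.hasDerivAt_flow`); then `exp (Φ t)` may be inserted, since continuity in
`η` and differentiability in `t` suffice (`integral_flow_eq`). Both differentiations rest on
`hasDerivAt_integral_mul_of_eq_sub_mul`, which uses the continuity of `w` in `L²`.
-/

namespace FracOU

open Filter Topology
open scoped ContDiff LineDeriv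

/-! ### The equation on the Fourier side -/

section Fourier

variable {N : ℕ}

/-- Multiplication formula `∫ f 𝓕ψ = ∫ 𝓕f ψ` for `f` in `L²`. -/
theorem integral_mul_fourier_eq (f : L2 N) (ψ : 𝓢(EuclideanSpace ℝ (Fin N), ℂ)) :
    ∫ x, f x * (𝓕 ψ) x = ∫ ξ, (𝓕 f : L2 N) ξ * ψ ξ := by
  have h := congrArg (fun S => S ψ) (Lp.fourier_toTemperedDistribution_eq f)
  simp only [TemperedDistribution.fourier_apply, Lp.toTemperedDistribution_apply,
    smul_eq_mul] at h
  simpa only [mul_comm] using h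

/-- The Schwartz function `ξ ↦ Dψ(ξ) (Bᵀ ξ)`, the drift term on the Fourier side. -/
noncomputable def fourierDrift (B : Matrix (Fin N) (Fin N) ℝ)
    (ψ : 𝓢(EuclideanSpace ℝ (Fin N), ℂ)) : 𝓢(EuclideanSpace ℝ (Fin N), ℂ) :=
  ∑ j : Fin N, SchwartzMap.smulLeftCLM ℂ (inner ℝ · (EuclideanSpace.single j (1 : ℝ)))
    (∂_{Matrix.toEuclideanLin B.transpose (EuclideanSpace.single j (1 : ℝ))} ψ)

theorem fourierDrift_apply (B : Matrix (Fin N) (Fin N) ℝ)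
    (ψ : 𝓢(EuclideanSpace ℝ (Fin N), ℂ)) (ξ : EuclideanSpace ℝ (Fin N)) :
    fourierDrift B ψ ξ = fderiv ℝ ψ ξ (Matrix.toEuclideanLin B.transpose ξ) := by
  have hξ : ξ = ∑ j, ξ j • EuclideanSpace.single j (1 : ℝ) := by
    ext i; simp [Finset.sum_apply, Pi.single_apply]
  conv_rhs => rw [hξ]
  simp only [map_sum, map_smul]
  rw [fourierDrift, _root_.sum_apply]
  refine Finset.sum_congr rfl fun j _ => ?_
  rw [SchwartzMap.smulLeftCLM_apply_apply (by fun_prop), SchwartzMap.lineDerivOp_apply_eq_fderiv,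
    ← hξ]
  simp [EuclideanSpace.inner_single_right]

/-- `div (𝓕ψ B x)` is the Fourier transform of `-Dψ (Bᵀ ξ)`: the two factors `2πi` and `-2πi` from
multiplication by `x` and from differentiation cancel, and no trace of `B` appears. -/
theorem divDrift_fourier (B : Matrix (Fin N) (Fin N) ℝ)
    (ψ : 𝓢(EuclideanSpace ℝ (Fin N), ℂ)) (x : EuclideanSpace ℝ (Fin N)) :
    divDrift B (𝓕 ψ) x = -(𝓕 (fourierDrift B ψ)) x := by
  have hcoord : ∀ (j : Fin N) (y : EuclideanSpace ℝ (Fin N)), Matrix.toEuclideanLin B y j =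
      inner ℝ y (Matrix.toEuclideanLin B.transpose (EuclideanSpace.single j (1 : ℝ))) := by
    intro j y
    simp [PiLp.inner_apply, Matrix.mulVec, dotProduct, Matrix.toLpLin_apply]
  have hterm : ∀ j : Fin N,
      fderiv ℝ (fun y : EuclideanSpace ℝ (Fin N) =>
        ((Matrix.toEuclideanLin B y j : ℝ) : ℂ) * (𝓕 ψ) y) x (EuclideanSpace.single j (1 : ℝ)) =
      -(𝓕 (SchwartzMap.smulLeftCLM ℂ (inner ℝ · (EuclideanSpace.single j (1 : ℝ)))
        (∂_{Matrix.toEuclideanLin B.transpose (EuclideanSpace.single j (1 : ℝ))} ψ))) x := by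
    intro j
    set m := Matrix.toEuclideanLin B.transpose (EuclideanSpace.single j (1 : ℝ)) with hm
    have hpi : (2 * Real.pi * Complex.I : ℂ) ≠ 0 := by simp [Real.pi_ne_zero]
    have h1 : (fun y : EuclideanSpace ℝ (Fin N) =>
        ((Matrix.toEuclideanLin B y j : ℝ) : ℂ) * (𝓕 ψ) y) =
        ((2 * Real.pi * Complex.I : ℂ)⁻¹ • 𝓕 (∂_{m} ψ) :
          𝓢(EuclideanSpace ℝ (Fin N), ℂ)) := by
      ext y
      rw [SchwartzMap.fourier_lineDerivOp_eq, smul_smul, inv_mul_cancel₀ hpi, one_smul,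
        SchwartzMap.smulLeftCLM_apply_apply (by fun_prop), hcoord]
      simp [hm]
    rw [h1, ← SchwartzMap.lineDerivOp_apply_eq_fderiv, LineDeriv.lineDerivOp_smul,
      SchwartzMap.lineDerivOp_fourier_eq, FourierTransform.fourier_smul, smul_smul, mul_neg,
      inv_mul_cancel₀ hpi]
    simp
  rw [divDrift, Finset.sum_congr rfl fun j _ => hterm j, fourierDrift]
  rw [FourierTransform.fourier_sum]
  simp

/-- The weak equation for `𝓕 u`, obtained by testing the equation for `u` with `𝓕 ψ`. -/
theorem IsSolution.hasDerivAt_integral_fourier {Q B : Matrix (Fin N) (Fin N) ℝ} {s T : ℝ}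
    {u₀ : L2 N} {u : ℝ → L2 N} (hu : IsSolution Q B s T u₀ u)
    (ψ : 𝓢(EuclideanSpace ℝ (Fin N), ℂ)) {t : ℝ} (ht : t ∈ Ioo 0 T) :
    HasDerivAt (fun τ => ∫ ξ, (𝓕 (u τ) : L2 N) ξ * ψ ξ)
      (-(∫ ξ, (symbol Q s ((2 * Real.pi) • ξ) : ℂ) * ((𝓕 (u t) : L2 N) ξ) * ψ ξ) +
        ∫ ξ, (𝓕 (u t) : L2 N) ξ * fderiv ℝ ψ ξ (Matrix.toEuclideanLin B.transpose ξ)) t := by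
  have h := hu.equation (𝓕 ψ) t ht
  simp only [integral_mul_fourier_eq, fracDiffusion, FourierTransform.fourierInv_fourier_eq, drift,
    divDrift_fourier, mul_neg, integral_neg, neg_neg, fourierDrift_apply] at h
  exact h

end Fourier

/-! ### Pairing `L²` functions with time-dependent test functions -/

section Pairing

variable {E : Type*} [NormedAddCommGroup E] [MeasurableSpace E]
  {μ : Measure E} [IsFiniteMeasureOnCompacts μ]

/-- On functions supported in a fixed compact set, the pairing with `L²` is bounded by the
sup norm. -/
theorem exists_norm_integral_mul_le {K : Set E} (hK : IsCompact K) :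
    ∃ C : ℝ, 0 ≤ C ∧ ∀ (f : Lp ℂ 2 μ) (ψ : E → ℂ) (δ : ℝ), 0 ≤ δ → (∀ x, ‖ψ x‖ ≤ δ) →
      (∀ x ∉ K, ψ x = 0) → ‖∫ x, f x * ψ x ∂μ‖ ≤ C * δ * ‖f‖ := by
  have : IsFiniteMeasure (μ.restrict K) := ⟨by
    rw [Measure.restrict_apply_univ]; exact hK.measure_lt_top⟩
  refine ⟨(μ K ^ (1 / (1 : ENNReal).toReal - 1 / (2 : ENNReal).toReal)).toReal,
    ENNReal.toReal_nonneg, fun f ψ δ hδ hψ hψK => ?_⟩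
  have hf2 : MemLp f 2 (μ.restrict K) := (Lp.memLp f).restrict K
  have hf1 : MemLp f 1 (μ.restrict K) := hf2.mono_exponent (by norm_num)
  have hint : Integrable f (μ.restrict K) := memLp_one_iff_integrable.1 hf1
  have hle : ∫ x in K, ‖f x‖ ∂μ ≤
      (μ K ^ (1 / (1 : ENNReal).toReal - 1 / (2 : ENNReal).toReal)).toReal * ‖f‖ := by
    rw [integral_norm_eq_lintegral_enorm hint.1, ← eLpNorm_one_eq_lintegral_enorm, Lp.norm_def,
      mul_comm, ← ENNReal.toReal_mul]
    refine ENNReal.toReal_mono ?_ ?_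
    · refine ENNReal.mul_ne_top (Lp.eLpNorm_ne_top f) ?_
      exact ENNReal.rpow_ne_top_of_nonneg (by norm_num) hK.measure_lt_top.ne
    · have h := eLpNorm_le_eLpNorm_mul_rpow_measure_univ (μ := μ.restrict K) (p := 1) (q := 2)
        (by norm_num) hint.1
      rw [Measure.restrict_apply_univ] at h
      refine h.trans ?_
      gcongr
      exact Measure.restrict_le_self
  rw [← setIntegral_eq_integral_of_forall_compl_eq_zero (s := K)
    (fun x hx => by rw [hψK x hx, mul_zero])]
  calc ‖∫ x in K, f x * ψ x ∂μ‖ ≤ ∫ x in K, ‖f x‖ * δ ∂μ := by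
        refine norm_integral_le_of_norm_le (hint.norm.mul_const δ)
          (Eventually.of_forall fun x => ?_)
        rw [norm_mul]
        exact mul_le_mul_of_nonneg_left (hψ x) (norm_nonneg _)
    _ = (∫ x in K, ‖f x‖ ∂μ) * δ := integral_mul_const _ _
    _ ≤ _ := by
        rw [mul_right_comm]
        gcongr

theorem integrable_Lp_mul [BorelSpace E] (f : Lp ℂ 2 μ) {ψ : E → ℂ} (hψ : Continuous ψ)
    (hc : HasCompactSupport ψ) : Integrable (fun x => f x * ψ x) μ :=
  MemLp.integrable_mul (p := 2) (q := 2) (Lp.memLp f) (hψ.memLp_of_hasCompactSupport hc)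

theorem continuousWithinAt_integral_mul [BorelSpace E] {w : ℝ → Lp ℂ 2 μ} {S : Set ℝ} {t : ℝ}
    (hw : ContinuousWithinAt w S t) {q : ℝ → E → ℂ} (hq : Continuous (Function.uncurry q))
    {K : Set E} (hK : IsCompact K) (hqK : ∀ τ ∈ Metric.closedBall t 1, ∀ x ∉ K, q τ x = 0) :
    ContinuousWithinAt (fun τ => ∫ x, w τ x * q τ x ∂μ) S t := by
  obtain ⟨C, hC, hCle⟩ := exists_norm_integral_mul_le (μ := μ) hK
  have ht : t ∈ Metric.closedBall t 1 := Metric.mem_closedBall_self zero_le_one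
  obtain ⟨D, hD⟩ := (((isCompact_closedBall t 1).prod hK).exists_bound_of_continuousOn
    hq.continuousOn)
  have hbound : ∀ τ ∈ Metric.closedBall t 1, ∀ x, ‖q τ x‖ ≤ max D 0 := by
    intro τ hτ x
    by_cases hx : x ∈ K
    · exact (hD (τ, x) ⟨hτ, hx⟩).trans (le_max_left _ _)
    · rw [hqK τ hτ x hx, norm_zero]; exact le_max_right _ _
  have hcont : ∀ τ, Continuous (q τ) := fun τ =>
    hq.comp (f := fun x => (τ, x)) (by fun_prop)
  have hcs : ∀ τ ∈ Metric.closedBall t 1, HasCompactSupport (q τ) := fun τ hτ =>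
    HasCompactSupport.intro hK (hqK τ hτ)
  have hball : Metric.closedBall t 1 ∈ 𝓝[S] t :=
    mem_nhdsWithin_of_mem_nhds (Metric.closedBall_mem_nhds t zero_lt_one)
  have hnorm : Tendsto (fun τ => ‖w τ - w t‖) (𝓝[S] t) (𝓝 0) :=
    tendsto_iff_norm_sub_tendsto_zero.1 hw
  rw [ContinuousWithinAt, Metric.tendsto_nhds]
  intro ε hε
  set η : ℝ := ε / 2 / (C * ‖w t‖ + 1) with hη
  have hden : 0 < C * ‖w t‖ + 1 := by positivity
  have hηpos : 0 < η := by positivity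
  obtain ⟨v, hv, hvle⟩ := hK.mem_uniformity_of_prod (f := q) (s := univ) (q := t)
    hq.continuousOn (mem_univ t) (Metric.dist_mem_uniformity hηpos)
  rw [nhdsWithin_univ] at hv
  have hsmall : ∀ᶠ τ in 𝓝[S] t, C * max D 0 * ‖w τ - w t‖ < ε / 2 := by
    have := hnorm.const_mul (C * max D 0)
    rw [mul_zero] at this
    exact this.eventually_lt_const (by positivity)
  filter_upwards [hsmall, hball, mem_nhdsWithin_of_mem_nhds hv] with τ h1 hτ hτv
  -- Vary `w` first and then `q`; the second term is small since `q τ → q t` uniformly on `K`.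
  have hsplit : (∫ x, w τ x * q τ x ∂μ) - ∫ x, w t x * q t x ∂μ =
      (∫ x, (w τ - w t) x * q τ x ∂μ) + ∫ x, w t x * (q τ x - q t x) ∂μ := by
    have e1 : ∫ x, (w τ - w t) x * q τ x ∂μ =
        (∫ x, w τ x * q τ x ∂μ) - ∫ x, w t x * q τ x ∂μ := by
      rw [← integral_sub (integrable_Lp_mul _ (hcont τ) (hcs τ hτ))
        (integrable_Lp_mul _ (hcont τ) (hcs τ hτ))]
      refine integral_congr_ae ?_
      filter_upwards [Lp.coeFn_sub (w τ) (w t)] with x hx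
      rw [hx, Pi.sub_apply, sub_mul]
    have e2 : ∫ x, w t x * (q τ x - q t x) ∂μ =
        (∫ x, w t x * q τ x ∂μ) - ∫ x, w t x * q t x ∂μ := by
      rw [← integral_sub (integrable_Lp_mul _ (hcont τ) (hcs τ hτ))
        (integrable_Lp_mul _ (hcont t) (hcs t ht))]
      simp only [mul_sub]
    rw [e1, e2]; ring
  have hA := hCle (w τ - w t) (q τ) (max D 0) (le_max_right _ _) (hbound τ hτ) (hqK τ hτ)
  have hB := hCle (w t) (fun x => q τ x - q t x) η hηpos.le (fun x => by
    by_cases hx : x ∈ K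
    · rw [← dist_eq_norm]; exact (hvle τ hτv x hx).le
    · rw [hqK τ hτ x hx, hqK t ht x hx, sub_zero, norm_zero]; exact hηpos.le)
    (fun x hx => by rw [hqK τ hτ x hx, hqK t ht x hx, sub_zero])
  rw [dist_eq_norm, hsplit]
  have hB' : C * η * ‖w t‖ ≤ ε / 2 := by
    rw [hη, mul_right_comm, mul_div_assoc', div_le_iff₀ hden, mul_comm]
    gcongr
    linarith
  calc _ ≤ _ := norm_add_le _ _
    _ < ε / 2 + ε / 2 := add_lt_add_of_lt_of_le (hA.trans_lt h1) (hB.trans hB')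
    _ = ε := add_halves ε

/-- Since `τ ↦ (τ - t) h τ` has derivative `h t` at `t` as soon as `h` is continuous there, a test
function which factors as `(τ - t) q τ` can be differentiated against an `L²`-continuous
function. -/
theorem hasDerivAt_integral_mul_of_eq_sub_mul [BorelSpace E] {w : ℝ → Lp ℂ 2 μ} {t : ℝ}
    (hw : ContinuousAt w t)
    {q : ℝ → E → ℂ} (hq : Continuous (Function.uncurry q))
    {K : Set E} (hK : IsCompact K) (hqK : ∀ τ ∈ Metric.closedBall t 1, ∀ x ∉ K, q τ x = 0) :
    HasDerivAt (fun τ => ∫ x, w τ x * (((τ - t : ℝ) : ℂ) * q τ x) ∂μ)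
      (∫ x, w t x * q t x ∂μ) t := by
  have hc := continuousWithinAt_integral_mul (S := univ) hw.continuousWithinAt hq hK hqK
  rw [continuousWithinAt_univ] at hc
  rw [hasDerivAt_iff_tendsto_slope]
  refine (hc.tendsto.mono_left nhdsWithin_le_nhds).congr' ?_
  filter_upwards [self_mem_nhdsWithin] with τ hτ
  have hne : ((τ - t : ℝ) : ℂ) ≠ 0 := by
    exact_mod_cast sub_ne_zero.2 hτ
  have h1 : ∀ σ, ∫ x, w σ x * (((σ - t : ℝ) : ℂ) * q σ x) ∂μ =
      ((σ - t : ℝ) : ℂ) * ∫ x, w σ x * q σ x ∂μ := by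
    intro σ
    rw [← integral_const_mul]
    congr 1; ext x; ring
  rw [slope, h1, h1]
  simp only [sub_self, Complex.ofReal_zero, zero_mul, vsub_eq_sub, sub_zero, Complex.real_smul]
  rw [Complex.ofReal_inv, inv_mul_cancel_left₀ hne]

end Pairing

/-- The difference quotient at `t` of a function with derivative `g'`, as a mean of `g'`. Unlike
the quotient itself, it is defined at `τ = t`, and it inherits joint continuity from `g'`. -/
noncomputable def meanDeriv {X : Type*} (g' : ℝ → X → ℂ) (t τ : ℝ) (x : X) : ℂ :=
  ∫ θ in (0 : ℝ)..1, g' (t + θ * (τ - t)) x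

section MeanDeriv

variable {X : Type*} {g g' : ℝ → X → ℂ}

theorem continuous_meanDeriv [TopologicalSpace X] (hg' : Continuous (Function.uncurry g'))
    (t : ℝ) :
    Continuous (Function.uncurry (meanDeriv g' t)) := by
  have : Continuous (fun p : (ℝ × X) × ℝ => g' (t + p.2 * (p.1.1 - t)) p.1.2) :=
    hg'.comp (f := fun p : (ℝ × X) × ℝ => (t + p.2 * (p.1.1 - t), p.1.2)) (by fun_prop)
  exact intervalIntegral.continuous_parametric_intervalIntegral_of_continuous'
    (f := fun (p : ℝ × X) θ => g' (t + θ * (p.1 - t)) p.2) this 0 1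

theorem meanDeriv_self (t : ℝ) (x : X) : meanDeriv g' t t x = g' t x := by
  simp [meanDeriv]

theorem sub_mul_meanDeriv [TopologicalSpace X] (hg' : Continuous (Function.uncurry g'))
    (hg : ∀ τ x, HasDerivAt (fun σ => g σ x) (g' τ x) τ) (t τ : ℝ) (x : X) :
    ((τ - t : ℝ) : ℂ) * meanDeriv g' t τ x = g τ x - g t x := by
  have hc : Continuous (fun θ : ℝ => g' (t + θ * (τ - t)) x) :=
    hg'.comp (f := fun θ : ℝ => (t + θ * (τ - t), x)) (by fun_prop)
  have hd : ∀ θ : ℝ, HasDerivAt (fun θ : ℝ => g (t + θ * (τ - t)) x)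
      (((τ - t : ℝ) : ℂ) * g' (t + θ * (τ - t)) x) θ := by
    intro θ
    have h1 : HasDerivAt (fun θ : ℝ => t + θ * (τ - t)) (τ - t) θ := by
      simpa using ((hasDerivAt_id θ).mul_const (τ - t)).const_add t
    have := (hg (t + θ * (τ - t)) x).scomp θ h1
    rw [Complex.real_smul] at this
    exact this
  have := intervalIntegral.integral_eq_sub_of_hasDerivAt (a := 0) (b := 1)
    (fun θ _ => hd θ) ((continuous_const.mul hc).intervalIntegrable 0 1)
  rw [intervalIntegral.integral_const_mul] at this
  rw [meanDeriv, this]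
  simp

theorem meanDeriv_eq_zero {t τ : ℝ} {x : X} (hτ : τ ∈ Metric.closedBall t 1)
    (h : ∀ σ ∈ Metric.closedBall t 1, g' σ x = 0) : meanDeriv g' t τ x = 0 := by
  rw [meanDeriv, intervalIntegral.integral_congr (g := fun _ => (0 : ℂ)),
    intervalIntegral.integral_zero]
  intro θ hθ
  rw [uIcc_of_le zero_le_one] at hθ
  refine h _ ?_
  rw [Metric.mem_closedBall, Real.dist_eq] at hτ ⊢
  rw [add_sub_cancel_left, abs_mul, abs_of_nonneg hθ.1]
  nlinarith [hθ.2, abs_nonneg (τ - t)]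

end MeanDeriv

/-! ### Linear flows -/

section Flow

variable {E : Type*} [NormedAddCommGroup E] [NormedSpace ℝ E]

/-- The linear flow `t ↦ exp (t A)`. -/
noncomputable def flow (A : E →L[ℝ] E) (t : ℝ) : E →L[ℝ] E := NormedSpace.exp (t • A)

@[simp] theorem flow_zero (A : E →L[ℝ] E) : flow A 0 = 1 := by simp [flow]

/-- The damping accumulated up to time `t` along the trajectory of `η`. -/
noncomputable def damping (a : E → ℝ) (A : E →L[ℝ] E) (t : ℝ) (η : E) : ℝ :=
  ∫ τ in (0 : ℝ)..t, a (flow A τ η)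

@[simp] theorem damping_zero (a : E → ℝ) (A : E →L[ℝ] E) (η : E) : damping a A 0 η = 0 := by
  simp [damping]

variable [CompleteSpace E] (A : E →L[ℝ] E)

theorem flow_add (t r : ℝ) : flow A (t + r) = flow A t * flow A r := by
  rw [flow, flow, flow, add_smul]
  let : NormedAlgebra ℚ (E →L[ℝ] E) := NormedAlgebra.restrictScalars ℚ ℝ _
  exact NormedSpace.exp_add_of_commute (((Commute.refl A).smul_left t).smul_right r)

@[simp] theorem flow_flow_neg (t : ℝ) (x : E) : flow A t (flow A (-t) x) = x := by
  rw [← mul_apply_eq_comp, ← flow_add]; simp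

@[simp] theorem flow_neg_flow (t : ℝ) (x : E) : flow A (-t) (flow A t x) = x := by
  rw [← mul_apply_eq_comp, ← flow_add]; simp

theorem hasDerivAt_flow (t : ℝ) : HasDerivAt (flow A) (flow A t * A) t :=
  hasDerivAt_exp_smul_const A t

theorem continuous_flow : Continuous (flow A) :=
  continuous_iff_continuousAt.2 fun t => (hasDerivAt_flow A t).continuousAt

@[fun_prop]
theorem continuous_flow_apply {Y : Type*} [TopologicalSpace Y] {f : Y → ℝ} {g : Y → E}
    (hf : Continuous f) (hg : Continuous g) : Continuous (fun y => flow A (f y) (g y)) :=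
  ((continuous_flow A).comp hf).clm_apply hg

/-- The flow equivalence at time `t`, whose inverse is the flow at time `-t`. -/
noncomputable def flowEquiv (t : ℝ) : E ≃L[ℝ] E :=
  ContinuousLinearEquiv.equivOfInverse (flow A t) (flow A (-t)) (flow_neg_flow A t)
    (flow_flow_neg A t)

theorem det_flow_ne_zero (t : ℝ) : (flow A t).det ≠ 0 :=
  (LinearEquiv.isUnit_det' (flowEquiv A t).toLinearEquiv).ne_zero

theorem abs_det_flow_pos (t : ℝ) : 0 < |(flow A t).det| :=
  abs_pos.2 (det_flow_ne_zero A t)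

/-- Over a compact set of times, the transported functions `χ ∘ flow A (-τ)` with support of `χ` in
`K` all vanish off one compact set. -/
theorem exists_isCompact_flow_neg_notMem {I : Set ℝ} (hI : IsCompact I) {K : Set E}
    (hK : IsCompact K) :
    ∃ L : Set E, IsCompact L ∧ ∀ τ ∈ I, ∀ x ∉ L, flow A (-τ) x ∉ K := by
  refine ⟨(fun p : ℝ × E => flow A p.1 p.2) '' I ×ˢ K, (hI.prod hK).image (by fun_prop), ?_⟩
  intro τ hτ x hx hxK
  exact hx ⟨(τ, flow A (-τ) x), ⟨hτ, hxK⟩, by simp⟩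

variable {A} {a : E → ℝ}

theorem continuous_damping (ha : Continuous a) : Continuous (Function.uncurry (damping a A)) := by
  have : Continuous (fun p : (ℝ × E) × ℝ => a (flow A p.2 p.1.2)) := by fun_prop
  exact intervalIntegral.continuous_parametric_intervalIntegral_of_continuous
    (f := fun (p : ℝ × E) τ => a (flow A τ p.2)) this continuous_fst

theorem hasDerivAt_damping (ha : Continuous a) (t : ℝ) (η : E) :
    HasDerivAt (fun τ => damping a A τ η) (a (flow A t η)) t := by
  have : Continuous (fun τ => a (flow A τ η)) := by fun_prop
  exact this.integral_hasStrictDerivAt 0 t |>.hasDerivAt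

end Flow

/-! ### Solution of the transport equation along characteristics -/

section WeakSolution

variable {E : Type*} [NormedAddCommGroup E] [NormedSpace ℝ E] [FiniteDimensional ℝ E]
  [MeasurableSpace E] [BorelSpace E] {μ : Measure E} [μ.IsAddHaarMeasure]

/-- Weak `L²`-solutions on `[0,T]` of the first-order equation
`∂ₜ w + div (w A ξ) + a w = 0`, tested against Schwartz functions. -/
structure IsTransportSolution (μ : Measure E) (a : E → ℝ) (A : E →L[ℝ] E) (T : ℝ)
    (w : ℝ → Lp ℂ 2 μ) : Prop where
  continuousOn : ContinuousOn w (Icc 0 T)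
  equation : ∀ ψ : 𝓢(E, ℂ), ∀ t ∈ Ioo 0 T,
    HasDerivAt (fun τ => ∫ x, w τ x * ψ x ∂μ)
      (-(∫ x, w t x * ((a x : ℂ) * ψ x) ∂μ) + ∫ x, w t x * fderiv ℝ ψ x (A x) ∂μ) t

variable {a : E → ℝ} {A : E →L[ℝ] E} {T : ℝ} {w : ℝ → Lp ℂ 2 μ}

/-- Test functions transported by the flow absorb the drift. -/
theorem IsTransportSolution.hasDerivAt_flow_of_contDiff (hw : IsTransportSolution μ a A T w)
    {χ : E → ℂ} (hχ : ContDiff ℝ ∞ χ) (hc : HasCompactSupport χ) {t : ℝ} (ht : t ∈ Ioo 0 T) :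
    HasDerivAt (fun τ => ∫ x, w τ x * χ (flow A (-τ) x) ∂μ)
      (-∫ x, w t x * ((a x : ℂ) * χ (flow A (-t) x)) ∂μ) t := by
  set g : ℝ → E → ℂ := fun τ x => χ (flow A (-τ) x) with hg
  set g' : ℝ → E → ℂ := fun τ x => -fderiv ℝ χ (flow A (-τ) x) (flow A (-τ) (A x)) with hg'
  have hg'c : Continuous (Function.uncurry g') := by
    refine Continuous.neg (Continuous.clm_apply ?_ (by fun_prop))
    exact (hχ.continuous_fderiv (by simp)).comp (by fun_prop)
  have hderiv : ∀ τ x, HasDerivAt (fun σ => g σ x) (g' τ x) τ := by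
    intro τ x
    have h1 : HasDerivAt (fun σ => flow A (-σ) x) (-(flow A (-τ) (A x))) τ := by
      have h := ((FracOU.hasDerivAt_flow A (-τ)).scomp τ (hasDerivAt_neg τ)).clm_apply
        (hasDerivAt_const τ x)
      convert! h using 1
      simp
    have h2 := ((hχ.differentiable (by simp)) (flow A (-τ) x)).hasFDerivAt.comp_hasDerivAt τ h1
    convert! h2 using 1
    simp [hg']
  obtain ⟨K, hK, hKn⟩ := exists_isCompact_flow_neg_notMem A (isCompact_closedBall t 1) hc
  have hgK : ∀ τ ∈ Metric.closedBall t 1, ∀ x ∉ K, g τ x = 0 := fun τ hτ x hx =>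
    image_eq_zero_of_notMem_tsupport (f := χ) (hKn τ hτ x hx)
  have hg'K : ∀ τ ∈ Metric.closedBall t 1, ∀ x ∉ K, g' τ x = 0 := by
    intro τ hτ x hx
    have : fderiv ℝ χ (flow A (-τ) x) = 0 := by
      by_contra h
      exact hKn τ hτ x hx (support_fderiv_subset ℝ h)
    simp [hg', this]
  have htt : t ∈ Metric.closedBall t 1 := Metric.mem_closedBall_self zero_le_one
  have hwt : ContinuousAt w t := hw.continuousOn.continuousAt (Icc_mem_nhds ht.1 ht.2)
  have hgt : HasCompactSupport (g t) := HasCompactSupport.intro hK (hgK t htt)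
  have hsmooth : ContDiff ℝ ∞ (g t) := hχ.comp (flow A (-t)).contDiff
  have h1 := hw.equation (hgt.toSchwartzMap hsmooth) t ht
  have h2 := hasDerivAt_integral_mul_of_eq_sub_mul hwt (continuous_meanDeriv hg'c t) hK
    fun τ hτ x hx => meanDeriv_eq_zero hτ fun σ hσ => hg'K σ hσ x hx
  have h3 := h1.add h2
  have hval : ∀ x, fderiv ℝ (hgt.toSchwartzMap hsmooth) x (A x) = -meanDeriv g' t t x := by
    intro x
    have hfd : HasFDerivAt (g t) ((fderiv ℝ χ (flow A (-t) x)).comp (flow A (-t))) x :=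
      ((hχ.differentiable (by simp)) (flow A (-t) x)).hasFDerivAt.comp x
        (flow A (-t)).hasFDerivAt
    rw [meanDeriv_self, hg', neg_neg]
    change fderiv ℝ (g t) x (A x) = _
    rw [hfd.fderiv]
    rfl
  simp only [hval, mul_neg, integral_neg, neg_add_cancel_right] at h3
  refine h3.congr_of_eventuallyEq ?_
  filter_upwards [Metric.closedBall_mem_nhds t zero_lt_one] with τ hτ
  rw [Pi.add_apply, ← integral_add]
  · refine integral_congr_ae (Eventually.of_forall fun x => ?_)
    change w τ x * g τ x = w τ x * g t x + w τ x * (((τ - t : ℝ) : ℂ) * meanDeriv g' t τ x)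
    linear_combination -(w τ x) * sub_mul_meanDeriv hg'c hderiv t τ x
  · exact integrable_Lp_mul _ hsmooth.continuous hgt
  · refine integrable_Lp_mul _ ?_ (HasCompactSupport.intro hK fun x hx => by
      rw [meanDeriv_eq_zero hτ fun σ hσ => hg'K σ hσ x hx, mul_zero])
    exact continuous_const.mul
      ((continuous_meanDeriv hg'c t).comp (f := fun x => (τ, x)) (by fun_prop))

/-- Only the values of `χ` enter the transported equation, so that smoothness of `χ` can be dropped
by uniform approximation within a fixed compact set. -/
theorem IsTransportSolution.hasDerivAt_flow (hw : IsTransportSolution μ a A T w)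
    (ha : Continuous a) {χ : E → ℂ} (hχ : Continuous χ) (hc : HasCompactSupport χ) {t : ℝ}
    (ht : t ∈ Ioo 0 T) :
    HasDerivAt (fun τ => ∫ x, w τ x * χ (flow A (-τ) x) ∂μ)
      (-∫ x, w t x * ((a x : ℂ) * χ (flow A (-t) x)) ∂μ) t := by
  obtain ⟨L, hL, hLK⟩ := exists_isCompact_flow_neg_notMem A (isCompact_Icc (a := 0) (b := T)) hc
  obtain ⟨C, hC, hCle⟩ := exists_norm_integral_mul_le (μ := μ) hL
  obtain ⟨W, hW⟩ := isCompact_Icc.exists_bound_of_continuousOn hw.continuousOn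
  obtain ⟨M, hM⟩ := hL.exists_bound_of_continuousOn ha.continuousOn
  have hW0 : 0 ≤ W := (norm_nonneg _).trans (hW t (Ioo_subset_Icc_self ht))
  choose χs hsmooth hclose hsupp using fun n : ℕ =>
    hχ.exists_contDiff_approx ⊤ (ε := fun _ => 1 / ((n : ℝ) + 1)) continuous_const
      (fun _ => Nat.one_div_pos_of_nat)
  have hcs : ∀ n, HasCompactSupport (χs n) := fun n => hc.mono (hsupp n)
  have hzero : ∀ τ ∈ Icc 0 T, ∀ x ∉ L, χ (flow A (-τ) x) = 0 := fun τ hτ x hx =>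
    image_eq_zero_of_notMem_tsupport (hLK τ hτ x hx)
  have hzeros : ∀ n, ∀ τ ∈ Icc 0 T, ∀ x ∉ L, χs n (flow A (-τ) x) = 0 := fun n τ hτ x hx =>
    image_eq_zero_of_notMem_tsupport fun h => hLK τ hτ x hx (closure_mono (hsupp n) h)
  -- Uniform approximation of `χ` passes to pairings with a fixed continuous weight `b`.
  have key : ∀ (b : E → ℝ), Continuous b → ∀ D : ℝ, 0 ≤ D → (∀ x ∈ L, ‖b x‖ ≤ D) → ∀ n,
      ∀ τ ∈ Icc 0 T, dist (∫ x, w τ x * ((b x : ℂ) * χ (flow A (-τ) x)) ∂μ)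
        (∫ x, w τ x * ((b x : ℂ) * χs n (flow A (-τ) x)) ∂μ) ≤
          C * (D * (1 / ((n : ℝ) + 1))) * W := by
    intro b hb D hD hbD n τ hτ
    have hi : ∀ φ : E → ℂ, Continuous φ → (∀ x ∉ L, φ (flow A (-τ) x) = 0) →
        Integrable (fun x => w τ x * ((b x : ℂ) * φ (flow A (-τ) x))) μ := by
      intro φ hφ h0
      refine integrable_Lp_mul _ (by fun_prop) (HasCompactSupport.intro hL fun x hx => ?_)
      rw [h0 x hx, mul_zero]
    rw [dist_eq_norm, ← integral_sub (hi χ hχ (hzero τ hτ))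
      (hi _ (hsmooth n).continuous (hzeros n τ hτ))]
    simp only [← mul_sub]
    refine (hCle (w τ) (fun x => (b x : ℂ) * (χ (flow A (-τ) x) - χs n (flow A (-τ) x)))
      (D * (1 / ((n : ℝ) + 1))) (by positivity) (fun x => ?_) (fun x hx => ?_)).trans ?_
    · by_cases hx : x ∈ L
      · rw [norm_mul, Complex.norm_real, ← dist_eq_norm, dist_comm]
        exact mul_le_mul (hbD x hx) (hclose n _).le dist_nonneg hD
      · rw [hzero τ hτ x hx, hzeros n τ hτ x hx, sub_zero, mul_zero, norm_zero]
        positivity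
    · rw [hzero τ hτ x hx, hzeros n τ hτ x hx, sub_zero, mul_zero]
    · gcongr
      exact hW τ hτ
  have hlim : ∀ D : ℝ, Tendsto (fun n : ℕ => C * (D * (1 / ((n : ℝ) + 1))) * W) atTop (𝓝 0) := by
    intro D
    have := ((tendsto_one_div_add_atTop_nhds_zero_nat (𝕜 := ℝ)).const_mul D).const_mul C
      |>.mul_const W
    simpa using this
  refine hasDerivAt_of_tendstoUniformlyOn isOpen_Ioo
    (f := fun n τ => ∫ x, w τ x * χs n (flow A (-τ) x) ∂μ)
    (f' := fun n τ => -∫ x, w τ x * ((a x : ℂ) * χs n (flow A (-τ) x)) ∂μ)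
    (g' := fun τ => -∫ x, w τ x * ((a x : ℂ) * χ (flow A (-τ) x)) ∂μ) (l := atTop) ?_
    (Eventually.of_forall fun n τ hτ => hw.hasDerivAt_flow_of_contDiff (hsmooth n) (hcs n) hτ)
    ?_ ht
  · rw [Metric.tendstoUniformlyOn_iff]
    intro ε hε
    filter_upwards [(hlim (max M 0)).eventually_lt_const hε] with n hn τ hτ
    rw [dist_neg_neg]
    exact (key a ha (max M 0) (le_max_right _ _) (fun x hx => (hM x hx).trans (le_max_left _ _))
      n τ (Ioo_subset_Icc_self hτ)).trans_lt hn
  · intro τ hτ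
    rw [tendsto_iff_dist_tendsto_zero]
    refine squeeze_zero (fun _ => dist_nonneg) (fun n => ?_) (hlim 1)
    have := key (fun _ => 1) continuous_const 1 zero_le_one (by simp) n τ
      (Ioo_subset_Icc_self hτ)
    simpa [dist_comm] using this

/-- The pairing with a test function that is transported by the flow and amplified by the
exponential of the damping is conserved. -/
theorem IsTransportSolution.integral_flow_eq (hw : IsTransportSolution μ a A T w)
    (ha : Continuous a) {χ : E → ℂ} (hχ : Continuous χ) (hc : HasCompactSupport χ) {t : ℝ}
    (ht : t ∈ Icc 0 T) :
    ∫ x, w t x * (χ (flow A (-t) x) * Real.exp (damping a A t (flow A (-t) x))) ∂μ =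
      ∫ x, w 0 x * χ x ∂μ := by
  set g : ℝ → E → ℂ := fun τ η => (Real.exp (damping a A τ η) : ℂ) with hg
  set g' : ℝ → E → ℂ := fun τ η => (a (flow A τ η) : ℂ) * g τ η with hg'
  have hgc : Continuous (Function.uncurry g) :=
    Complex.continuous_ofReal.comp (Real.continuous_exp.comp (continuous_damping ha))
  have hg'c : Continuous (Function.uncurry g') := by
    refine Continuous.mul (Complex.continuous_ofReal.comp ?_) hgc
    exact ha.comp (by fun_prop)
  have hderiv : ∀ τ η, HasDerivAt (fun σ => g σ η) (g' τ η) τ := by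
    intro τ η
    have := ((hasDerivAt_damping (A := A) ha τ η).exp).ofReal_comp
    convert! this using 1
    simp [hg', hg, mul_comm]
  have hzero : ∀ t : ℝ, ∃ K : Set E, IsCompact K ∧
      ∀ τ ∈ Metric.closedBall t 1, ∀ x ∉ K, χ (flow A (-τ) x) = 0 := by
    intro t
    obtain ⟨K, hK, h⟩ := exists_isCompact_flow_neg_notMem A (isCompact_closedBall t 1) hc
    exact ⟨K, hK, fun τ hτ x hx => image_eq_zero_of_notMem_tsupport (h τ hτ x hx)⟩
  have hpull : ∀ {h : ℝ → E → ℂ}, Continuous (Function.uncurry h) →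
      Continuous (Function.uncurry fun τ x => χ (flow A (-τ) x) * h τ (flow A (-τ) x)) := by
    intro h hh
    refine Continuous.mul (hχ.comp (by fun_prop)) ?_
    exact hh.comp (f := fun p : ℝ × E => (p.1, flow A (-p.1) p.2)) (by fun_prop)
  set F : ℝ → ℂ := fun τ => ∫ x, w τ x * (χ (flow A (-τ) x) * g τ (flow A (-τ) x)) ∂μ with hF
  have hFc : ContinuousOn F (Icc 0 T) := by
    intro r hr
    obtain ⟨K, hK, hKz⟩ := hzero r
    exact continuousWithinAt_integral_mul (hw.continuousOn r hr) (hpull hgc) hK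
      fun τ hτ x hx => by rw [hKz τ hτ x hx, zero_mul]
  have hFd : ∀ r ∈ Ioo 0 T, HasDerivAt F 0 r := by
    intro r hr
    obtain ⟨K, hK, hKz⟩ := hzero r
    have hwr : ContinuousAt w r := hw.continuousOn.continuousAt (Icc_mem_nhds hr.1 hr.2)
    have hgr : Continuous (g r) := hgc.comp (f := fun x => (r, x)) (by fun_prop)
    have h1 := hw.hasDerivAt_flow ha (χ := fun x => χ x * g r x) (by fun_prop) hc.mul_right hr
    have h2 := hasDerivAt_integral_mul_of_eq_sub_mul hwr (hpull (continuous_meanDeriv hg'c r)) hK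
      (fun τ hτ x hx => by rw [hKz τ hτ x hx, zero_mul])
    -- `h1` differentiates with the factor `g` frozen at time `r`; `h2` accounts for its variation.
    have h3 := h1.add h2
    have hval : (-∫ x, w r x * ((a x : ℂ) * (χ (flow A (-r) x) * g r (flow A (-r) x))) ∂μ) +
        ∫ x, w r x * (χ (flow A (-r) x) * meanDeriv g' r r (flow A (-r) x)) ∂μ = 0 := by
      rw [neg_add_eq_zero]
      congr 1; ext x
      rw [meanDeriv_self, hg']
      simp only [flow_flow_neg]
      ring
    rw [hval] at h3
    refine h3.congr_of_eventuallyEq ?_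
    filter_upwards [Metric.closedBall_mem_nhds r zero_lt_one] with τ hτ
    have hsub := fun x => sub_mul_meanDeriv hg'c hderiv r τ x
    rw [Pi.add_apply, ← integral_add]
    · refine integral_congr_ae (Eventually.of_forall fun x => ?_)
      simp only
      linear_combination -(w τ x) * χ (flow A (-τ) x) * hsub (flow A (-τ) x)
    · exact integrable_Lp_mul _ (by fun_prop)
        (HasCompactSupport.intro hK fun x hx => by rw [hKz τ hτ x hx, zero_mul])
    · refine integrable_Lp_mul _ ?_
        (HasCompactSupport.intro hK fun x hx => by rw [hKz τ hτ x hx, zero_mul, mul_zero])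
      exact continuous_const.mul
        ((hpull (continuous_meanDeriv hg'c r)).comp (f := fun x => (τ, x)) (by fun_prop))
  have hconst := intervalIntegral.integral_eq_sub_of_hasDerivAt_of_le ht.1
    (hFc.mono (Icc_subset_Icc_right ht.2)) (f' := fun _ => 0)
    (fun r hr => hFd r ⟨hr.1, hr.2.trans_le ht.2⟩) intervalIntegrable_const
  rw [intervalIntegral.integral_zero, eq_comm, sub_eq_zero] at hconst
  rw [hF] at hconst
  simpa [hg] using hconst

end WeakSolution

/-! ### Interpolation of norms -/

section Interpolation

open scoped ENNReal

variable {E : Type*} [NormedAddCommGroup E] [NormedSpace ℝ E] [FiniteDimensional ℝ E]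
  [MeasurableSpace E] [BorelSpace E] {μ : Measure E} [μ.IsAddHaarMeasure]

theorem map_flow (A : E →L[ℝ] E) (t : ℝ) :
    Measure.map (flow A t) μ = ENNReal.ofReal |(flow A t).det|⁻¹ • μ := by
  have := Measure.map_linearMap_addHaar_eq_smul_addHaar μ (f := (flow A t : E →ₗ[ℝ] E))
    (det_flow_ne_zero A t)
  rw [abs_inv] at this
  exact this

theorem measurableEmbedding_flow (A : E →L[ℝ] E) (t : ℝ) : MeasurableEmbedding (flow A t) :=
  (flowEquiv A t).toHomeomorph.measurableEmbedding

theorem lintegral_comp_flow (A : E →L[ℝ] E) (t : ℝ) (f : E → ℝ≥0∞) :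
    ∫⁻ x, f (flow A t x) ∂μ = ENNReal.ofReal |(flow A t).det|⁻¹ * ∫⁻ x, f x ∂μ := by
  rw [← (measurableEmbedding_flow A t).lintegral_map, map_flow, lintegral_smul_measure, smul_eq_mul]

theorem integral_comp_flow (A : E →L[ℝ] E) (t : ℝ) (f : E → ℂ) :
    ∫ x, f (flow A t x) ∂μ = ((|(flow A t).det|⁻¹ : ℝ) : ℂ) * ∫ x, f x ∂μ := by
  rw [← (measurableEmbedding_flow A t).integral_map, map_flow, integral_smul_measure,
    ENNReal.toReal_ofReal (inv_nonneg.2 (abs_nonneg _)), Complex.real_smul]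

theorem memLp_comp_flow (A : E →L[ℝ] E) (t : ℝ) (f : Lp ℂ 2 μ) :
    MemLp (fun x => f (flow A t x)) 2 μ := by
  have h := (Lp.memLp f).smul_measure (c := ENNReal.ofReal |(flow A t).det|⁻¹)
    ENNReal.ofReal_ne_top
  rw [← map_flow] at h
  exact h.comp_of_map (flow A t).continuous.aemeasurable

variable {a : E → ℝ} {A : E →L[ℝ] E} {T : ℝ} {w : ℝ → Lp ℂ 2 μ}

/-- The solution formula along the characteristics. -/
theorem IsTransportSolution.ae_eq (hw : IsTransportSolution μ a A T w) (ha : Continuous a) {t : ℝ}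
    (ht : t ∈ Icc 0 T) :
    ∀ᵐ η ∂μ, w t (flow A t η) * (Real.exp (damping a A t η) : ℂ) =
      ((|(flow A t).det|⁻¹ : ℝ) : ℂ) * w 0 η := by
  have hd : Continuous (damping a A t) :=
    (continuous_damping ha).comp (f := fun x => (t, x)) (by fun_prop)
  refine ae_eq_of_integral_contDiff_smul_eq ?_ ?_ fun χ hχ hc => ?_
  · exact ((memLp_comp_flow A t (w t)).locallyIntegrable (by norm_num)).mul_continuous
      (by fun_prop)
  · exact ((Lp.memLp (w 0)).const_mul _).locallyIntegrable (by norm_num)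
  · have h := hw.integral_flow_eq ha (χ := fun x => (χ x : ℂ)) (by fun_prop)
      (hc.comp_left Complex.ofReal_zero) ht
    have h1 := integral_comp_flow (μ := μ) A t (fun x => w t x * ((χ (flow A (-t) x) : ℂ) *
      Real.exp (damping a A t (flow A (-t) x))))
    rw [h] at h1
    simp only [flow_neg_flow] at h1
    rw [← integral_const_mul] at h1
    calc _ = _ := by
          congr 1; ext x; rw [Complex.real_smul, mul_left_comm]
      _ = _ := h1
      _ = _ := by congr 1; ext x; rw [Complex.real_smul]; ring

/-- The `L²` norm at time `t` as a weighted norm of the initial value. One of the two Jacobian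
factors from the solution formula cancels in the change of variables. -/
theorem IsTransportSolution.enorm_sq_eq (hw : IsTransportSolution μ a A T w) (ha : Continuous a)
    {t : ℝ} (ht : t ∈ Icc 0 T) :
    ‖w t‖ₑ ^ 2 = ENNReal.ofReal |(flow A t).det|⁻¹ *
      ∫⁻ η, ENNReal.ofReal (Real.exp (-2 * damping a A t η)) * ‖w 0 η‖ₑ ^ 2 ∂μ := by
  have hsq : ∀ f : Lp ℂ 2 μ, ‖f‖ₑ ^ 2 = ∫⁻ x, ‖f x‖ₑ ^ 2 ∂μ := by
    intro f
    have := eLpNorm_nnreal_pow_eq_lintegral (μ := μ) (f := f) (p := 2) two_ne_zero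
    rw [Lp.enorm_def]
    simpa using this
  set c : ℝ := |(flow A t).det|⁻¹ with hc
  have hcpos : 0 < c := inv_pos.2 (abs_det_flow_pos A t)
  have hc0 : ENNReal.ofReal c ≠ 0 := (ENNReal.ofReal_pos.2 hcpos).ne'
  have h1 := lintegral_comp_flow (μ := μ) A t (fun x => ‖w t x‖ₑ ^ 2)
  rw [← hsq] at h1
  have h2 : ∫⁻ η, ‖w t (flow A t η)‖ₑ ^ 2 ∂μ = ENNReal.ofReal c * (ENNReal.ofReal c *
      ∫⁻ η, ENNReal.ofReal (Real.exp (-2 * damping a A t η)) * ‖w 0 η‖ₑ ^ 2 ∂μ) := by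
    rw [← lintegral_const_mul' _ _ ENNReal.ofReal_ne_top,
      ← lintegral_const_mul' _ _ ENNReal.ofReal_ne_top]
    refine lintegral_congr_ae ?_
    filter_upwards [hw.ae_eq ha ht] with η hη
    have hv : w t (flow A t η) = ((c * Real.exp (-damping a A t η) : ℝ) : ℂ) * w 0 η := by
      rw [Complex.ofReal_mul, mul_right_comm, ← hη, mul_assoc, ← Complex.ofReal_mul,
        ← Real.exp_add, add_neg_cancel, Real.exp_zero, Complex.ofReal_one, mul_one]
    have hn : ‖w t (flow A t η)‖ₑ =
        ENNReal.ofReal c * ENNReal.ofReal (Real.exp (-damping a A t η)) * ‖w 0 η‖ₑ := by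
      rw [hv, enorm_mul, ← ENNReal.ofReal_mul hcpos.le, ← ofReal_norm, Complex.norm_real,
        Real.norm_of_nonneg (by positivity)]
    have he : ENNReal.ofReal (Real.exp (-2 * damping a A t η)) =
        ENNReal.ofReal (Real.exp (-damping a A t η)) ^ 2 := by
      rw [← ENNReal.ofReal_pow (Real.exp_pos _).le, ← Real.exp_nat_mul]
      congr 2; push_cast; ring
    rw [hn, he]; ring
  rw [h2] at h1
  exact ((ENNReal.mul_right_inj hc0 ENNReal.ofReal_ne_top).1 h1).symm

/-- If the damping up to time `t` is at least the fraction `θ` of the damping up to time `T`,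
Hölder's inequality interpolates the norm at time `t` between the norms at times `0` and `T`. -/
theorem IsTransportSolution.norm_le (hw : IsTransportSolution μ a A T w) (ha : Continuous a)
    {t : ℝ} (ht : t ∈ Icc 0 T) {θ : ℝ} (hθ0 : 0 ≤ θ) (hθ1 : θ ≤ 1)
    (hθ : ∀ η, θ * damping a A T η ≤ damping a A t η) {D : ℝ} (hD1 : 1 ≤ D)
    (hDt : |(flow A t).det|⁻¹ ≤ D) (hDT : |(flow A T).det| ≤ D) :
    ‖w t‖ ≤ D * ‖w 0‖ ^ (1 - θ) * ‖w T‖ ^ θ := by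
  have hT0 : (0 : ℝ) ≤ T := ht.1.trans ht.2
  set I : ℝ → ℝ≥0∞ := fun r =>
    ∫⁻ η, ENNReal.ofReal (Real.exp (-2 * damping a A r η)) * ‖w 0 η‖ₑ ^ 2 ∂μ with hI
  have hmeas : AEMeasurable (fun η => ‖w 0 η‖ₑ ^ 2) μ :=
    (Lp.aestronglyMeasurable (w 0)).enorm.pow_const 2
  have hmeasT : AEMeasurable (fun η =>
      ENNReal.ofReal (Real.exp (-2 * damping a A T η)) * ‖w 0 η‖ₑ ^ 2) μ := by
    have : Continuous (damping a A T) :=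
      (continuous_damping ha).comp (f := fun x => (T, x)) (by fun_prop)
    exact (ENNReal.measurable_ofReal.comp (by fun_prop : Continuous fun η =>
      Real.exp (-2 * damping a A T η)).measurable).aemeasurable.mul hmeas
  have hI0 : ‖w 0‖ₑ ^ 2 = ∫⁻ η, ‖w 0 η‖ₑ ^ 2 ∂μ := by
    rw [hw.enorm_sq_eq ha ⟨le_rfl, hT0⟩]
    simp [ContinuousLinearMap.det]
  have hIT : I T = ENNReal.ofReal |(flow A T).det| * ‖w T‖ₑ ^ 2 := by
    rw [hw.enorm_sq_eq ha ⟨hT0, le_rfl⟩, ← mul_assoc, ← ENNReal.ofReal_mul (abs_nonneg _),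
      mul_inv_cancel₀ (abs_det_flow_pos A T).ne', ENNReal.ofReal_one, one_mul]
  have hholder : I t ≤ (I T) ^ θ * (‖w 0‖ₑ ^ 2) ^ (1 - θ) := by
    rw [hI0]
    refine le_trans (lintegral_mono fun η => ?_) (ENNReal.lintegral_mul_norm_pow_le hmeasT hmeas
      hθ0 (sub_nonneg.2 hθ1) (add_sub_cancel θ 1))
    rw [ENNReal.mul_rpow_of_nonneg _ _ hθ0, mul_assoc, ← ENNReal.rpow_add_of_nonneg _ _ hθ0
      (sub_nonneg.2 hθ1), add_sub_cancel, ENNReal.rpow_one,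
      ENNReal.ofReal_rpow_of_pos (Real.exp_pos _), ← Real.exp_mul]
    gcongr ENNReal.ofReal (Real.exp ?_) * _
    nlinarith [hθ η]
  have hfinal : ‖w t‖ₑ ^ 2 ≤ ENNReal.ofReal |(flow A t).det|⁻¹ *
      ((ENNReal.ofReal |(flow A T).det| * ‖w T‖ₑ ^ 2) ^ θ * (‖w 0‖ₑ ^ 2) ^ (1 - θ)) := by
    rw [hw.enorm_sq_eq ha ht, ← hIT]
    gcongr
  have hreal : ‖w t‖ ^ 2 ≤ |(flow A t).det|⁻¹ *
      ((|(flow A T).det| * ‖w T‖ ^ 2) ^ θ * (‖w 0‖ ^ 2) ^ (1 - θ)) := by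
    have h := ENNReal.toReal_mono (by
      refine ENNReal.mul_ne_top ENNReal.ofReal_ne_top (ENNReal.mul_ne_top ?_ ?_)
      · exact ENNReal.rpow_ne_top_of_nonneg hθ0
          (ENNReal.mul_ne_top ENNReal.ofReal_ne_top (by simp))
      · exact ENNReal.rpow_ne_top_of_nonneg (sub_nonneg.2 hθ1) (by simp)) hfinal
    simpa only [ENNReal.toReal_mul, ENNReal.toReal_pow, ← ENNReal.toReal_rpow, toReal_enorm,
      ENNReal.toReal_ofReal (abs_nonneg _),
      ENNReal.toReal_ofReal (inv_nonneg.2 (abs_nonneg _))] using h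
  have hsq : ∀ (x y : ℝ), 0 ≤ x → (x ^ 2) ^ y = (x ^ y) ^ 2 := by
    intro x y hx
    rw [← Real.rpow_natCast, ← Real.rpow_mul hx, mul_comm, Real.rpow_mul hx, Real.rpow_natCast]
  have hDθ : |(flow A T).det| ^ θ ≤ D := by
    calc |(flow A T).det| ^ θ ≤ D ^ θ := Real.rpow_le_rpow (abs_nonneg _) hDT hθ0
      _ ≤ D ^ (1 : ℝ) := Real.rpow_le_rpow_of_exponent_le hD1 hθ1
      _ = D := Real.rpow_one D
  refine le_of_sq_le_sq ?_ (by positivity)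
  calc ‖w t‖ ^ 2 ≤ _ := hreal
    _ = |(flow A t).det|⁻¹ * (|(flow A T).det| ^ θ *
          ((‖w T‖ ^ θ) ^ 2 * (‖w 0‖ ^ (1 - θ)) ^ 2)) := by
        rw [Real.mul_rpow (abs_nonneg _) (sq_nonneg _), hsq _ _ (norm_nonneg _),
          hsq _ _ (norm_nonneg _), mul_assoc]
    _ ≤ D * (D * ((‖w T‖ ^ θ) ^ 2 * (‖w 0‖ ^ (1 - θ)) ^ 2)) := by
        gcongr
    _ = (D * ‖w 0‖ ^ (1 - θ) * ‖w T‖ ^ θ) ^ 2 := by ring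

end Interpolation

/-! ### Comparison of the symbol with itself along the flow -/

section Symbol

theorem exists_norm_flow_le {E : Type*} [NormedAddCommGroup E] [NormedSpace ℝ E] [CompleteSpace E]
    (A : E →L[ℝ] E) (T : ℝ) :
    ∃ L : ℝ, 1 ≤ L ∧ ∀ τ ∈ Icc (-T) T, ‖flow A τ‖ ≤ L := by
  obtain ⟨L, hL⟩ := isCompact_Icc.exists_bound_of_continuousOn (s := Icc (-T) T)
    (continuous_flow A).continuousOn
  exact ⟨max L 1, le_max_right _ _, fun τ hτ => (hL τ hτ).trans (le_max_left _ _)⟩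

theorem exists_abs_det_flow_le {E : Type*} [NormedAddCommGroup E] [NormedSpace ℝ E]
    [FiniteDimensional ℝ E] (A : E →L[ℝ] E) (T : ℝ) :
    ∃ D : ℝ, 1 ≤ D ∧ ∀ τ ∈ Icc 0 T, |(flow A τ).det| ≤ D ∧ |(flow A τ).det|⁻¹ ≤ D := by
  have hc : Continuous fun τ => |(flow A τ).det| :=
    (ContinuousLinearMap.continuous_det.comp (continuous_flow A)).abs
  obtain ⟨D₁, h₁⟩ := isCompact_Icc.exists_bound_of_continuousOn (s := Icc 0 T) hc.continuousOn
  obtain ⟨D₂, h₂⟩ := isCompact_Icc.exists_bound_of_continuousOn (s := Icc 0 T)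
    (hc.inv₀ fun τ => (abs_det_flow_pos A τ).ne').continuousOn
  refine ⟨max 1 (max D₁ D₂), le_max_left _ _, fun τ hτ => ⟨?_, ?_⟩⟩
  · exact (le_abs_self _).trans ((h₁ τ hτ).trans ((le_max_left _ _).trans (le_max_right _ _)))
  · exact (le_abs_self _).trans ((h₂ τ hτ).trans ((le_max_right _ _).trans (le_max_right _ _)))

variable {N : ℕ}

theorem exists_mul_norm_sq_le_inner {Q : Matrix (Fin N) (Fin N) ℝ} (hQ : Q.PosDef) :
    ∃ p : ℝ, 0 < p ∧ ∀ ξ : EuclideanSpace ℝ (Fin N),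
      p * ‖ξ‖ ^ 2 ≤ inner ℝ (Matrix.toEuclideanLin Q ξ) ξ := by
  have hpos : ∀ ξ : EuclideanSpace ℝ (Fin N), ξ ≠ 0 →
      0 < inner ℝ (Matrix.toEuclideanLin Q ξ) ξ := by
    intro ξ hξ
    have h := hQ.dotProduct_mulVec_pos (x := ξ.ofLp) (by simpa using hξ)
    simpa [PiLp.inner_apply, dotProduct, Matrix.toLpLin_apply] using h
  have hcont : Continuous fun ξ : EuclideanSpace ℝ (Fin N) =>
      inner ℝ (Matrix.toEuclideanLin Q ξ) ξ :=
    (Matrix.toEuclideanLin Q).continuous_of_finiteDimensional.inner continuous_id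
  -- In dimension zero the unit sphere is empty and every `p` works.
  rcases (Metric.sphere (0 : EuclideanSpace ℝ (Fin N)) 1).eq_empty_or_nonempty with he | hne
  · refine ⟨1, one_pos, fun ξ => ?_⟩
    have hξ : ξ = 0 := by
      by_contra hξ
      have : ‖ξ‖⁻¹ • ξ ∈ Metric.sphere (0 : EuclideanSpace ℝ (Fin N)) 1 := by
        simp [norm_smul, hξ]
      rw [he] at this
      exact this
    simp [hξ]
  · obtain ⟨ξ₀, hξ₀, hmin⟩ := (isCompact_sphere _ _).exists_isMinOn hne hcont.continuousOn
    refine ⟨_, hpos ξ₀ (ne_zero_of_mem_unit_sphere ⟨ξ₀, hξ₀⟩), fun ξ => ?_⟩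
    by_cases hξ : ξ = 0
    · simp [hξ]
    have hn : 0 < ‖ξ‖ := norm_pos_iff.2 hξ
    have h := hmin (show ‖ξ‖⁻¹ • ξ ∈ Metric.sphere (0 : EuclideanSpace ℝ (Fin N)) 1 by
      simp [norm_smul, hξ])
    simp only [mem_ofPred_eq, map_smul, inner_smul_left, inner_smul_right, RCLike.conj_to_real] at h
    calc _ ≤ _ := mul_le_mul_of_nonneg_right h (sq_nonneg _)
      _ = _ := by field_simp

/-- Along the flow on `[0,T]` the symbol is comparable with itself at any other time, uniformly in
the frequency, because `⟨Q ξ, ξ⟩` is comparable to `|ξ|²`. -/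
theorem exists_mul_symbol_flow_le {Q : Matrix (Fin N) (Fin N) ℝ} (hQ : Q.PosDef) {s : ℝ}
    (hs : 0 < s) (A : EuclideanSpace ℝ (Fin N) →L[ℝ] EuclideanSpace ℝ (Fin N)) (T : ℝ) :
    ∃ c ∈ Ioc (0 : ℝ) 1, ∀ τ ∈ Icc 0 T, ∀ σ ∈ Icc 0 T, ∀ η,
      c * symbol Q s ((2 * Real.pi) • flow A σ η) ≤ symbol Q s ((2 * Real.pi) • flow A τ η) := by
  obtain ⟨p, hp, hpl⟩ := exists_mul_norm_sq_le_inner hQ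
  obtain ⟨L, hL1, hL⟩ := exists_norm_flow_le A T
  set M : ℝ := ‖(Matrix.toEuclideanLin Q).toContinuousLinearMap‖ + 1 with hM
  have hMpos : 0 < M := by positivity
  have hup : ∀ ξ : EuclideanSpace ℝ (Fin N),
      inner ℝ (Matrix.toEuclideanLin Q ξ) ξ ≤ M * ‖ξ‖ ^ 2 := by
    intro ξ
    have h1 := (Matrix.toEuclideanLin Q).toContinuousLinearMap.le_opNorm ξ
    calc inner ℝ (Matrix.toEuclideanLin Q ξ) ξ ≤ ‖Matrix.toEuclideanLin Q ξ‖ * ‖ξ‖ :=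
          real_inner_le_norm _ _
      _ ≤ (M * ‖ξ‖) * ‖ξ‖ := by
          gcongr
          refine h1.trans ?_
          gcongr
          linarith
      _ = M * ‖ξ‖ ^ 2 := by ring
  set κ : ℝ := min 1 (p / (M * L ^ 2)) with hκ
  have hκpos : 0 < κ := by positivity
  refine ⟨κ ^ s, ⟨by positivity, Real.rpow_le_one hκpos.le (min_le_left _ _) hs.le⟩, ?_⟩
  intro τ hτ σ hσ η
  set x := (2 * Real.pi) • flow A τ η with hx
  set y := (2 * Real.pi) • flow A σ η with hy
  have hxy : y = flow A (σ - τ) x := by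
    rw [hy, hx, map_smul, ← mul_apply_eq_comp, ← flow_add, sub_add_cancel]
  have hnorm : ‖y‖ ≤ L * ‖x‖ := by
    rw [hxy]
    exact (flow A (σ - τ)).le_of_opNorm_le
      (hL _ ⟨by linarith [hσ.1, hτ.2], by linarith [hσ.2, hτ.1]⟩) x
  have hy0 : 0 ≤ inner ℝ (Matrix.toEuclideanLin Q y) y := (by positivity : (0:ℝ) ≤ _).trans (hpl y)
  rw [symbol, symbol, ← Real.mul_rpow hκpos.le hy0]
  refine Real.rpow_le_rpow (by positivity) ?_ hs.le
  calc κ * inner ℝ (Matrix.toEuclideanLin Q y) y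
      ≤ (p / (M * L ^ 2)) * (M * (L * ‖x‖) ^ 2) := by
        refine mul_le_mul (min_le_right _ _) ((hup y).trans ?_) hy0 (by positivity)
        gcongr
    _ = p * ‖x‖ ^ 2 := by
        have : L ≠ 0 := by positivity
        field_simp
    _ ≤ _ := hpl x

theorem continuous_symbol (Q : Matrix (Fin N) (Fin N) ℝ) {s : ℝ} (hs : 0 < s) :
    Continuous (symbol Q s) :=
  ((Matrix.toEuclideanLin Q).continuous_of_finiteDimensional.inner continuous_id).rpow_const
    fun _ => Or.inr hs.le

end Symbol

theorem mul_damping_le {E : Type*} [NormedAddCommGroup E] [NormedSpace ℝ E] [CompleteSpace E]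
    {a : E → ℝ} (ha : Continuous a) {A : E →L[ℝ] E} {T : ℝ} (hT : 0 < T) {c : ℝ}
    (hc : ∀ τ ∈ Icc 0 T, ∀ σ ∈ Icc 0 T, ∀ η, c * a (flow A σ η) ≤ a (flow A τ η))
    {t : ℝ} (ht : t ∈ Icc 0 T) (η : E) :
    c * (t / T) * damping a A T η ≤ damping a A t η := by
  have hcont : Continuous fun τ => a (flow A τ η) := by fun_prop
  have hpt : ∀ τ ∈ Icc 0 t, c * damping a A T η / T ≤ a (flow A τ η) := by
    intro τ hτ
    have h := intervalIntegral.integral_mono_on (μ := volume) hT.le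
      (f := fun σ => c * a (flow A σ η)) ((continuous_const.mul hcont).intervalIntegrable 0 T)
      (continuous_const.intervalIntegrable 0 T)
      fun σ hσ => hc τ ⟨hτ.1, hτ.2.trans ht.2⟩ σ hσ η
    rw [intervalIntegral.integral_const_mul, intervalIntegral.integral_const, sub_zero,
      smul_eq_mul] at h
    rw [div_le_iff₀ hT, mul_comm _ T]
    exact h
  have h := intervalIntegral.integral_mono_on (μ := volume) ht.1
    (continuous_const.intervalIntegrable 0 t) (hcont.intervalIntegrable 0 t) hpt
  rw [intervalIntegral.integral_const, sub_zero, smul_eq_mul] at h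
  calc _ = t * (c * damping a A T η / T) := by ring
    _ ≤ _ := h

/-! ### The interpolation inequality -/

/-- The Fourier transform turns the drift `B x · ∇` into transport along `exp (t Bᵀ)`. -/
theorem IsSolution.isTransportSolution_fourier {N : ℕ} {Q B : Matrix (Fin N) (Fin N) ℝ} {s T : ℝ}
    {u₀ : L2 N} {u : ℝ → L2 N} (hu : IsSolution Q B s T u₀ u) :
    IsTransportSolution volume (fun ξ => symbol Q s ((2 * Real.pi) • ξ))
      (Matrix.toEuclideanLin B.transpose).toContinuousLinearMap T (fun t => 𝓕 (u t)) where
  continuousOn := (FourierTransform.fourierCLM ℂ (L2 N)).continuous.comp_continuousOn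
    hu.continuousOn
  equation ψ t ht := by
    have h := hu.hasDerivAt_integral_fourier ψ ht
    convert! h using 4
    ext ξ
    ring

end FracOU

theorem proposition3 {N : ℕ} (Q B : Matrix (Fin N) (Fin N) ℝ) (hQ : Q.PosDef) :
    ∃ c K : ℝ → ℝ → ℝ, ∀ s T : ℝ, 0 < s → 0 < T →
      c s T ∈ Set.Ioc (0 : ℝ) 1 ∧ 0 < K (c s T) T ∧
      ∀ (u₀ : FracOU.L2 N) (u : ℝ → FracOU.L2 N), FracOU.IsSolution Q B s T u₀ u →
        ∀ t ∈ Set.Icc (0 : ℝ) T,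
          ‖u t‖ ≤ K (c s T) T * ‖u₀‖ ^ (1 - c s T * (t / T)) * ‖u T‖ ^ (c s T * (t / T)) := by
  set A := (Matrix.toEuclideanLin B.transpose).toContinuousLinearMap with hA
  choose D hD1 hD using FracOU.exists_abs_det_flow_le A
  choose c hc hcle using fun (s T : ℝ) (hs : 0 < s) => FracOU.exists_mul_symbol_flow_le hQ hs A T
  refine ⟨fun s T => if hs : 0 < s then c s T hs else 1, fun _ T => D T, fun s T hs hT => ?_⟩
  simp only [dif_pos hs]
  refine ⟨hc s T hs, zero_lt_one.trans_le (hD1 T), fun u₀ u hu t ht => ?_⟩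
  have ha : Continuous fun ξ : EuclideanSpace ℝ (Fin N) =>
      FracOU.symbol Q s ((2 * Real.pi) • ξ) :=
    (FracOU.continuous_symbol Q hs).comp (by fun_prop)
  have htT : t / T ≤ 1 := (div_le_one hT).2 ht.2
  have ht0 : 0 ≤ t / T := div_nonneg ht.1 hT.le
  have h := hu.isTransportSolution_fourier.norm_le ha ht
    (θ := c s T hs * (t / T)) (mul_nonneg (hc s T hs).1.le ht0)
    (mul_le_one₀ (hc s T hs).2 ht0 htT)
    (FracOU.mul_damping_le ha hT (hcle s T hs) ht) (hD1 T) (hD T t ht).2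
    (hD T T ⟨hT.le, le_rfl⟩).1
  simpa only [Lp.norm_fourier_eq, hu.initial] using h
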